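/- Let $m \ge 2$ be an integer. Let $\{3,m\}$ be the regular tessellation by equilateral triangles, $m$ around each vertex, of the sphere ($m \le 5$; for $m = 2$ its vertices are three equidistant points of a great circle), the Euclidean plane ($m = 6$) or the hyperbolic plane ($m \ge 7$). Its vertex set is the orbit of one vertex under the group generated by the reflections in the sides of the geodesic triangle with angles $\pi/m$, $\pi/2$, $\pi/3$ at a vertex, the midpoint of an adjacent edge and the centre of an adjacent face, respectively. The Schläfli quandle $X_m$ related to $\{3,m\}$ is the set of vertices with the operation $v * w = r_w(v)$, where $r_w$ is the counterclockwise rotation about $w$ through the angle $2\pi/m$. Then $X_m$ has the presentations $$\langle v, w \mid (v*w)*v = w,\ (w*v)*w = v,\ w *^m v = w\rangle = \langle v, w \mid (v*w)*v = w,\ (((v*w)*v)*v)*w = v,\ w *^m v = w\rangle$$ as a quandle, where $w *^m v = (\cdots((w*v)*v)\cdots)*v$ with $m$ factors $v$. That is, $X_m$ is isomorphic to each of the two presented quandles, by isomorphisms that send the generators $v$, $w$ of the one and of the other to the same two elements of $X_m$. -/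

import Mathlib

noncomputable section

/-! ## Quandles given by generators and relations

The right operation `x * y` used for quandles in knot theory is, in Mathlib's notation for quandles,
`Shelf.act y x` (that is, `y ◃ x`): the element `y` acts on `x`. -/

/-- Formal quandle words in the generators `S`: `star a b` is the word `a * b`, and `starInv a b` is
the word for the preimage of `a` under the bijection `(· * b)`. -/
inductive QuandleWord (S : Type*) where
  | gen : S → QuandleWord S
  | star : QuandleWord S → QuandleWord S → QuandleWord S
  | starInv : QuandleWord S → QuandleWord S → QuandleWord S

infixl:70 " ◂ " => QuandleWord.star

/-- The congruence on quandle words generated by the quandle axioms and the relations `R`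
(a pair `(a, b) ∈ R` being the relation `a = b`). -/
inductive QuandleWord.Equal {S : Type*} (R : Set (QuandleWord S × QuandleWord S)) :
    QuandleWord S → QuandleWord S → Prop where
  | rel {a b} : (a, b) ∈ R → Equal R a b
  | refl (a) : Equal R a a
  | symm {a b} : Equal R a b → Equal R b a
  | trans {a b c} : Equal R a b → Equal R b c → Equal R a c
  | congr_star {a a' b b'} : Equal R a a' → Equal R b b' → Equal R (a ◂ b) (a' ◂ b')
  | congr_starInv {a a' b b'} :
      Equal R a a' → Equal R b b' → Equal R (a.starInv b) (a'.starInv b')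
  | idem (a) : Equal R (a ◂ a) a
  | star_starInv (a b) : Equal R ((a ◂ b).starInv b) a
  | starInv_star (a b) : Equal R ((a.starInv b) ◂ b) a
  | distrib (a b c) : Equal R ((a ◂ b) ◂ c) ((a ◂ c) ◂ (b ◂ c))

/-- The setoid of the congruence generated by the relations `R`. -/
def QuandleWord.setoid {S : Type*} (R : Set (QuandleWord S × QuandleWord S)) :
    Setoid (QuandleWord S) where
  r := QuandleWord.Equal R
  iseqv := ⟨.refl, .symm, .trans⟩

/-- The quandle `⟨S ∣ R⟩` with generators `S` and relations `R`. -/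
def PresentedQuandle {S : Type*} (R : Set (QuandleWord S × QuandleWord S)) : Type _ :=
  Quotient (QuandleWord.setoid R)

namespace PresentedQuandle

/-- The class of a word in the presented quandle. -/
def mk {S : Type*} (R : Set (QuandleWord S × QuandleWord S)) (a : QuandleWord S) :
    PresentedQuandle R :=
  Quotient.mk (QuandleWord.setoid R) a

/-- The generators of the presented quandle. -/
def of {S : Type*} (R : Set (QuandleWord S × QuandleWord S)) (s : S) : PresentedQuandle R :=
  mk R (QuandleWord.gen s)

instance {S : Type*} (R : Set (QuandleWord S × QuandleWord S)) : Quandle (PresentedQuandle R) where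
  act x y := Quotient.map₂ (fun b a => a ◂ b) (fun _ _ hb _ _ ha => .congr_star ha hb) x y
  invAct x y :=
    Quotient.map₂ (fun b a => a.starInv b) (fun _ _ hb _ _ ha => .congr_starInv ha hb) x y
  self_distrib := by
    rintro ⟨a⟩ ⟨b⟩ ⟨c⟩
    exact Quotient.sound (.distrib c b a)
  left_inv := by
    rintro ⟨a⟩ ⟨b⟩
    exact Quotient.sound (.star_starInv b a)
  right_inv := by
    rintro ⟨a⟩ ⟨b⟩
    exact Quotient.sound (.starInv_star b a)
  fix := by
    rintro ⟨a⟩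
    exact Quotient.sound (.idem a)

end PresentedQuandle

/-! ## The regular tessellation `{p, q}` and its Schläfli quandle

The three simply connected surfaces of constant curvature are used in their standard linear models
in `ℝ³`: the sphere `x² + y² + z² = 1` (`κ = 1`), the plane `z = 1` (`κ = 0`) and the upper sheet of
the hyperboloid `z² - x² - y² = 1` (`κ = -1`). All three are `κ (x² + y²) + z² = 1`, with `z > 0`
for `κ ≤ 0`; the lines are the intersections with the planes through the origin. -/

namespace Schlafli

/-- The bilinear form `κ (p₀ x₀ + p₁ x₁) + p₂ x₂` of the model of curvature `κ`. -/
def form (κ : ℝ) (p x : Fin 3 → ℝ) : ℝ := κ * (p 0 * x 0 + p 1 * x 1) + p 2 * x 2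

/-- The cross product of the model of curvature `κ`: the usual one for `κ = 1`, the Lorentzian one
for `κ = -1`, and, for points `p` and `x` of the plane `z = 1` (`κ = 0`), the vector `x - p` turned
counterclockwise through a right angle. -/
def cross (κ : ℝ) (p x : Fin 3 → ℝ) : Fin 3 → ℝ :=
  ![p 1 * x 2 - p 2 * x 1, p 2 * x 0 - p 0 * x 2, κ * (p 0 * x 1 - p 1 * x 0)]

/-- The counterclockwise rotation through the angle `θ` about the point `p` (Rodrigues' formula).
For `κ = 0` and points of the plane `z = 1` it is `p + cos θ • (x - p) + sin θ • J (x - p)`, where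
`J` is the counterclockwise rotation of vectors through a right angle. -/
def rotation (κ θ : ℝ) (p x : Fin 3 → ℝ) : Fin 3 → ℝ :=
  Real.cos θ • x + Real.sin θ • cross κ p x + ((1 - Real.cos θ) * form κ p x) • p

/-- The linear functional `n₀ x₀ + n₁ x₁ + n₂ x₂`, whose kernel cuts out a line of the model. -/
def functional (n : Fin 3 → ℝ) : Module.Dual ℝ (Fin 3 → ℝ) :=
  n 0 • LinearMap.proj 0 + n 1 • LinearMap.proj 1 + n 2 • LinearMap.proj 2

theorem functional_normal {κ : ℝ} {n : Fin 3 → ℝ} (h : n 0 ^ 2 + n 1 ^ 2 + κ * n 2 ^ 2 = 1) :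
    functional n ((2 : ℝ) • ![n 0, n 1, κ * n 2]) = 2 := by
  simp [functional]
  linear_combination 2 * h

/-- The reflection in the line `n₀ x₀ + n₁ x₁ + n₂ x₂ = 0`, where the normal `n` is a unit
covector: `x ↦ x - 2 n(x) • (n₀, n₁, κ n₂)`. -/
def reflection {κ : ℝ} {n : Fin 3 → ℝ} (h : n 0 ^ 2 + n 1 ^ 2 + κ * n 2 ^ 2 = 1) :
    (Fin 3 → ℝ) ≃ₗ[ℝ] (Fin 3 → ℝ) :=
  Module.reflection (functional_normal h)

/-- For the right-angled geodesic triangle with the angles `π / q` at a vertex, `π / 2` at the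
midpoint of an edge and `π / p` at the centre of a face of `{p, q}`, this is
`cos d`, `1` or `cosh d` on the sphere, the plane and the hyperbolic plane respectively, where `d`
is half the length of an edge. -/
def cosHalfEdge (p q : ℕ) : ℝ := Real.cos (Real.pi / p) / Real.sin (Real.pi / q)

/-- The curvature `1`, `0` or `-1` of the surface that carries `{p, q}`. -/
def curvature (p q : ℕ) : ℝ := SignType.sign (1 - cosHalfEdge p q ^ 2)

open Classical in
/-- `sin d`, `d` or `sinh d`, where `d` is half the length of an edge. In the plane, where
the size of the tessellation is arbitrary, `d = 1`. -/
def sinHalfEdge (p q : ℕ) : ℝ :=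
  if cosHalfEdge p q ^ 2 = 1 then 1 else Real.sqrt |1 - cosHalfEdge p q ^ 2|

theorem cosHalfEdge_sq_add (p q : ℕ) :
    cosHalfEdge p q ^ 2 + curvature p q * sinHalfEdge p q ^ 2 = 1 := by
  unfold curvature sinHalfEdge
  split_ifs with h
  · simp [h]
  · rw [Real.sq_sqrt (abs_nonneg _), sign_mul_abs]
    ring

/-- The vertex `(0, 0, 1)` of the tessellation. -/
def baseVertex : Fin 3 → ℝ := ![0, 0, 1]

/-- The reflection in the line through the base vertex and the midpoint
`(sin d, 0, cos d)` of an edge (`cos d` and `sin d` read as above). -/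
def edgeReflection (p q : ℕ) : (Fin 3 → ℝ) ≃ₗ[ℝ] (Fin 3 → ℝ) :=
  reflection (κ := curvature p q) (n := ![0, 1, 0]) (by simp)

/-- The reflection in the line through the base vertex that makes the angle `π / q` with the edge;
it passes through the centre of a face. -/
def faceReflection (p q : ℕ) : (Fin 3 → ℝ) ≃ₗ[ℝ] (Fin 3 → ℝ) :=
  reflection (κ := curvature p q) (n := ![Real.sin (Real.pi / q), -Real.cos (Real.pi / q), 0])
    (by simp)

/-- The reflection in the perpendicular bisector of the edge. -/
def bisectorReflection (p q : ℕ) : (Fin 3 → ℝ) ≃ₗ[ℝ] (Fin 3 → ℝ) :=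
  reflection (κ := curvature p q) (n := ![cosHalfEdge p q, 0, -sinHalfEdge p q])
    (by simpa using cosHalfEdge_sq_add p q)

/-- The symmetry group of the regular tessellation `{p, q}`: the group generated by the reflections
in the sides of the geodesic triangle with the angles `π / q`, `π / 2` and `π / p` at the
base vertex, the midpoint of an edge and the centre of a face. -/
def symmetryGroup (p q : ℕ) : Subgroup ((Fin 3 → ℝ) ≃ₗ[ℝ] (Fin 3 → ℝ)) :=
  Subgroup.closure {edgeReflection p q, faceReflection p q, bisectorReflection p q}

/-- The set of vertices of the regular tessellation `{p, q}`: the orbit of the base vertex under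
the symmetry group. -/
def vertices (p q : ℕ) : Set (Fin 3 → ℝ) := {v | ∃ g ∈ symmetryGroup p q, g baseVertex = v}

/-- The rotation `r_v` of the tessellation `{p, q}` about a vertex `v` through `2π / q`. -/
def vertexRotation (p q : ℕ) (v x : Fin 3 → ℝ) : Fin 3 → ℝ :=
  rotation (curvature p q) (2 * Real.pi / q) v x

/-- Reflections preserve the form and reverse the cross product. -/
theorem reflection_form {κ : ℝ} {n : Fin 3 → ℝ} (h : n 0 ^ 2 + n 1 ^ 2 + κ * n 2 ^ 2 = 1)
    (x y : Fin 3 → ℝ) : form κ (reflection h x) (reflection h y) = form κ x y := by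
  simp [reflection, Module.reflection_apply, functional, form]
  linear_combination (4 * κ * (n 0 * x 0 + n 1 * x 1 + n 2 * x 2) *
    (n 0 * y 0 + n 1 * y 1 + n 2 * y 2)) * h

theorem reflection_cross {κ : ℝ} {n : Fin 3 → ℝ} (h : n 0 ^ 2 + n 1 ^ 2 + κ * n 2 ^ 2 = 1)
    (x y : Fin 3 → ℝ) :
    cross κ (reflection h x) (reflection h y) = (-1 : ℝ) • reflection h (cross κ x y) := by
  ext i
  fin_cases i
  · simp [reflection, Module.reflection_apply, functional, cross]
    linear_combination (-2 * (x 1 * y 2 - x 2 * y 1)) * h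
  · simp [reflection, Module.reflection_apply, functional, cross]
    linear_combination (-2 * (x 2 * y 0 - x 0 * y 2)) * h
  · simp [reflection, Module.reflection_apply, functional, cross]
    linear_combination (-2 * κ * (x 0 * y 1 - x 1 * y 0)) * h

/-- A symmetry preserves the form, and preserves or reverses the cross product. -/
theorem symmetry_form_cross {p q : ℕ} {g : (Fin 3 → ℝ) ≃ₗ[ℝ] (Fin 3 → ℝ)}
    (hg : g ∈ symmetryGroup p q) :
    (∀ x y, form (curvature p q) (g x) (g y) = form (curvature p q) x y) ∧
    ∃ ε : ℝ, (ε = 1 ∨ ε = -1) ∧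
      ∀ x y, cross (curvature p q) (g x) (g y) = ε • g (cross (curvature p q) x y) := by
  induction hg using Subgroup.closure_induction with
  | mem g hg =>
    rcases hg with rfl | rfl | rfl
    all_goals exact ⟨reflection_form _, -1, Or.inr rfl, reflection_cross _⟩
  | one => exact ⟨fun _ _ => rfl, 1, Or.inl rfl, fun _ _ => by simp⟩
  | mul g h _ _ ihg ihh =>
    obtain ⟨hg, ε, hε, hgc⟩ := ihg
    obtain ⟨hh, δ, hδ, hhc⟩ := ihh
    refine ⟨fun x y => by simp [hg, hh], ε * δ, ?_, fun x y => ?_⟩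
    · rcases hε with rfl | rfl <;> rcases hδ with rfl | rfl <;> simp
    · simp [hgc, hhc, smul_smul]
  | inv g _ ih =>
    obtain ⟨hg, ε, hε, hgc⟩ := ih
    refine ⟨fun x y => ?_, ε, hε, fun x y => ?_⟩
    · rw [← hg]
      simp
    · apply g.injective
      have := hgc (g⁻¹ x) (g⁻¹ y)
      simp only [← LinearEquiv.mul_apply, mul_inv_cancel, LinearEquiv.coe_one, id] at this
      rw [map_smul, ← LinearEquiv.mul_apply, mul_inv_cancel, LinearEquiv.coe_one, id, this,
        smul_smul]
      rcases hε with rfl | rfl <;> simp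

theorem rotation_map {κ : ℝ} {g : (Fin 3 → ℝ) ≃ₗ[ℝ] (Fin 3 → ℝ)} {ε : ℝ} (hε : ε = 1 ∨ ε = -1)
    (hf : ∀ x y, form κ (g x) (g y) = form κ x y)
    (hc : ∀ x y, cross κ (g x) (g y) = ε • g (cross κ x y)) (θ : ℝ) (v x : Fin 3 → ℝ) :
    rotation κ θ (g v) (g x) = g (rotation κ (ε * θ) v x) := by
  rcases hε with rfl | rfl <;> simp [rotation, hf, hc]

theorem rotation_apply (κ θ : ℝ) (p x : Fin 3 → ℝ) (i : Fin 3) :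
    rotation κ θ p x i =
      Real.cos θ * x i + Real.sin θ * cross κ p x i + ((1 - Real.cos θ) * form κ p x) * p i :=
  rfl

theorem reflection_apply {κ : ℝ} {n : Fin 3 → ℝ} (h : n 0 ^ 2 + n 1 ^ 2 + κ * n 2 ^ 2 = 1)
    (x : Fin 3 → ℝ) (i : Fin 3) :
    reflection h x i =
      x i - (n 0 * x 0 + n 1 * x 1 + n 2 * x 2) * (2 * ![n 0, n 1, κ * n 2] i) := by
  fin_cases i <;> simp [reflection, Module.reflection_apply, functional]

theorem rotation_base (p q : ℕ) (x : Fin 3 → ℝ) :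
    rotation (curvature p q) (2 * Real.pi / q) baseVertex x =
      (faceReflection p q * edgeReflection p q) x := by
  have hθ : 2 * Real.pi / q = 2 * (Real.pi / q) := by ring
  have h := Real.sin_sq_add_cos_sq (Real.pi / q)
  rw [hθ]
  ext i
  rw [LinearEquiv.mul_apply, rotation_apply, faceReflection, edgeReflection, reflection_apply]
  simp only [reflection_apply]
  fin_cases i
  · simp [baseVertex, cross, form, Real.cos_two_mul, Real.sin_two_mul]
    linear_combination (2 * x 0) * h
  · simp [baseVertex, cross, form, Real.cos_two_mul, Real.sin_two_mul]
    ring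
  · simp [baseVertex, cross, form, Real.cos_two_mul, Real.sin_two_mul]
    ring

theorem rotation_neg_base (p q : ℕ) (x : Fin 3 → ℝ) :
    rotation (curvature p q) (-(2 * Real.pi / q)) baseVertex x =
      (faceReflection p q * edgeReflection p q)⁻¹ x := by
  have key : ∀ y, rotation (curvature p q) (-(2 * Real.pi / q)) baseVertex
      (rotation (curvature p q) (2 * Real.pi / q) baseVertex y) = y := by
    intro y
    have h := Real.sin_sq_add_cos_sq (2 * Real.pi / q)
    ext i
    rw [rotation_apply]
    fin_cases i
    · simp [rotation_apply, baseVertex, cross, form]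
      linear_combination y 0 * h
    · simp [rotation_apply, baseVertex, cross, form]
      linear_combination y 1 * h
    · simp [rotation_apply, baseVertex, cross, form]
      ring
  have := key ((faceReflection p q * edgeReflection p q)⁻¹ x)
  rw [rotation_base, ← LinearEquiv.mul_apply, mul_inv_cancel] at this
  exact this

/-- The rotation about a vertex is a symmetry, whose inverse is the rotation through the
opposite angle. -/
theorem exists_symmetry {p q : ℕ} {v : Fin 3 → ℝ} (hv : v ∈ vertices p q) :
    ∃ h ∈ symmetryGroup p q, (∀ x, vertexRotation p q v x = h x) ∧
      (∀ x, rotation (curvature p q) (-(2 * Real.pi / q)) v x = h⁻¹ x) ∧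
      ∀ x y, cross (curvature p q) (h x) (h y) = h (cross (curvature p q) x y) := by
  obtain ⟨g, hg, rfl⟩ := hv
  obtain ⟨hf, ε, hε, hc⟩ := symmetry_form_cross hg
  set r := faceReflection p q * edgeReflection p q with hr
  have hmem : r ∈ symmetryGroup p q :=
    mul_mem (Subgroup.subset_closure (by simp)) (Subgroup.subset_closure (by simp))
  have hrc : ∀ x y, cross (curvature p q) (r x) (r y) = r (cross (curvature p q) x y) := by
    intro x y
    simp only [hr, LinearEquiv.mul_apply, faceReflection, edgeReflection]
    rw [reflection_cross, reflection_cross]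
    simp
  have hrc' : ∀ x y, cross (curvature p q) (r⁻¹ x) (r⁻¹ y) = r⁻¹ (cross (curvature p q) x y) := by
    intro x y
    apply r.injective
    rw [← hrc]
    simp
  have conj : ∀ s : (Fin 3 → ℝ) ≃ₗ[ℝ] (Fin 3 → ℝ),
      (∀ x y, cross (curvature p q) (s x) (s y) = s (cross (curvature p q) x y)) →
      ∀ x y, cross (curvature p q) ((g * s * g⁻¹) x) ((g * s * g⁻¹) y) =
        (g * s * g⁻¹) (cross (curvature p q) x y) := by
    intro s hs x y
    have h1 := hc (g⁻¹ x) (g⁻¹ y)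
    simp only [← LinearEquiv.mul_apply, mul_inv_cancel, LinearEquiv.coe_one, id] at h1
    simp only [LinearEquiv.mul_apply]
    rw [hc, hs, h1, map_smul, map_smul, map_smul, ← LinearEquiv.mul_apply g⁻¹ g, inv_mul_cancel]
    rfl
  have act : ∀ (θ : ℝ) (s : (Fin 3 → ℝ) ≃ₗ[ℝ] (Fin 3 → ℝ)),
      (∀ x, rotation (curvature p q) (ε * θ) baseVertex x = s x) →
      ∀ x, rotation (curvature p q) θ (g baseVertex) x = (g * s * g⁻¹) x := by
    intro θ s hs x
    have h1 := rotation_map hε hf hc θ baseVertex (g⁻¹ x)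
    rw [← LinearEquiv.mul_apply g g⁻¹, mul_inv_cancel, hs] at h1
    exact h1
  rcases hε with rfl | rfl
  · refine ⟨g * r * g⁻¹, mul_mem (mul_mem hg hmem) (inv_mem hg), ?_, ?_, conj r hrc⟩
    · exact act _ r fun x => by rw [one_mul]; exact rotation_base p q x
    · rw [show (g * r * g⁻¹)⁻¹ = g * r⁻¹ * g⁻¹ by group]
      exact act _ r⁻¹ fun x => by rw [one_mul]; exact rotation_neg_base p q x
  · refine ⟨g * r⁻¹ * g⁻¹, mul_mem (mul_mem hg (inv_mem hmem)) (inv_mem hg), ?_, ?_, conj r⁻¹ hrc'⟩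
    · exact act _ r⁻¹ fun x => by rw [neg_one_mul]; exact rotation_neg_base p q x
    · rw [show (g * r⁻¹ * g⁻¹)⁻¹ = g * r * g⁻¹ by group]
      exact act _ r fun x => by rw [neg_one_mul, neg_neg]; exact rotation_base p q x

theorem form_self {p q : ℕ} {v : Fin 3 → ℝ} (hv : v ∈ vertices p q) :
    form (curvature p q) v v = 1 := by
  obtain ⟨g, hg, rfl⟩ := hv
  rw [(symmetry_form_cross hg).1]
  simp [form, baseVertex]

theorem vertexRotation_self {p q : ℕ} {v : Fin 3 → ℝ} (hv : v ∈ vertices p q) :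
    vertexRotation p q v v = v := by
  ext i
  have hc : cross (curvature p q) v v i = 0 := by
    fin_cases i <;> simp [cross, mul_comm]
  rw [vertexRotation, rotation_apply, form_self hv, hc]
  ring

theorem symmetry_mem {p q : ℕ} {h : (Fin 3 → ℝ) ≃ₗ[ℝ] (Fin 3 → ℝ)} (hh : h ∈ symmetryGroup p q)
    {v : Fin 3 → ℝ} (hv : v ∈ vertices p q) : h v ∈ vertices p q := by
  obtain ⟨g, hg, rfl⟩ := hv
  exact ⟨h * g, mul_mem hh hg, rfl⟩

theorem vertexRotation_mem {p q : ℕ} {w v : Fin 3 → ℝ} (hw : w ∈ vertices p q)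
    (hv : v ∈ vertices p q) : vertexRotation p q w v ∈ vertices p q := by
  obtain ⟨h, hh, h1, -⟩ := exists_symmetry hw
  rw [h1]
  exact symmetry_mem hh hv

theorem vertexRotation_inv_mem {p q : ℕ} {w v : Fin 3 → ℝ} (hw : w ∈ vertices p q)
    (hv : v ∈ vertices p q) :
    rotation (curvature p q) (-(2 * Real.pi / q)) w v ∈ vertices p q := by
  obtain ⟨h, hh, -, h2, -⟩ := exists_symmetry hw
  rw [h2]
  exact symmetry_mem (inv_mem hh) hv

end Schlafli

open Schlafli in
/-- The Schläfli quandle related to `{p, q}`: its elements are the vertices `v` of the regular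
tessellation `{p, q}` (each with its rotation `r_v`), and `v * w = r_w v`. -/
def SchlafliQuandle (p q : ℕ) : Type := {v : Fin 3 → ℝ // v ∈ vertices p q}

open Schlafli in
instance (p q : ℕ) : Quandle (SchlafliQuandle p q) where
  act w v := ⟨vertexRotation p q w.1 v.1, vertexRotation_mem w.2 v.2⟩
  invAct w v :=
    ⟨rotation (curvature p q) (-(2 * Real.pi / q)) w.1 v.1, vertexRotation_inv_mem w.2 v.2⟩
  self_distrib := by
    intro x y z
    apply Subtype.ext
    obtain ⟨h, hh, h1, -, h3⟩ := exists_symmetry x.2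
    have h4 := rotation_map (ε := 1) (Or.inl rfl) (symmetry_form_cross hh).1
      (fun a b => by rw [one_smul]; exact h3 a b) (2 * Real.pi / q) y.1 z.1
    rw [one_mul] at h4
    simp only [h1]
    exact h4.symm
  left_inv := by
    intro w v
    apply Subtype.ext
    obtain ⟨h, -, h1, h2, -⟩ := exists_symmetry w.2
    simp [h1, h2, ← LinearEquiv.mul_apply]
  right_inv := by
    intro w v
    apply Subtype.ext
    obtain ⟨h, -, h1, h2, -⟩ := exists_symmetry w.2
    simp [h1, h2]
  fix := by
    intro v
    apply Subtype.ext
    exact vertexRotation_self v.2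

/-! ## The two presentations -/

/-- The word `a *ᵐ b`, that is, `(⋯ ((a * b) * b) ⋯) * b` with `m` factors `b`. -/
def QuandleWord.starPow {S : Type*} (a b : QuandleWord S) (m : ℕ) : QuandleWord S :=
  (fun c => c ◂ b)^[m] a

/-- The relations `(v * w) * v = w`, `(w * v) * w = v` and `w *ᵐ v = w` in the generators
`v = gen 0` and `w = gen 1`. -/
def schlafliRelations (m : ℕ) : Set (QuandleWord (Fin 2) × QuandleWord (Fin 2)) :=
  let v := QuandleWord.gen 0
  let w := QuandleWord.gen 1
  {((v ◂ w) ◂ v, w), ((w ◂ v) ◂ w, v), (w.starPow v m, w)}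

/-- The relations `(v * w) * v = w`, `(((v * w) * v) * v) * w = v` and `w *ᵐ v = w` in the
generators `v = gen 0` and `w = gen 1`. -/
def schlafliRelations' (m : ℕ) : Set (QuandleWord (Fin 2) × QuandleWord (Fin 2)) :=
  let v := QuandleWord.gen 0
  let w := QuandleWord.gen 1
  {((v ◂ w) ◂ v, w), ((((v ◂ w) ◂ v) ◂ v) ◂ w, v), (w.starPow v m, w)}

end

/-!
The three lines through the sides of the fundamental triangle are the walls of a chamber of the
Coxeter group `W` with the orders `m`, `3`, `2`: in the linear model of the surface their reflections
act as the dual of the geometric representation, whatever the sign of the curvature. The proof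
compares the actions of `W` on the tessellation and on the presented quandle `Q = ⟨v, w⟩`.

The relations of `Q` make `W` act on it (`SchlafliPresentation.exists_rep`). They also hold for the
inverse operation, with `v` and `w` in either order, so the reflection in the edge `vw` and the one
in its bisector can be defined on `Q` as antihomomorphisms that fix, respectively exchange, the two
generators; the third reflection is the action of `v` after the first one. The relations of `W` are
identities between homomorphisms, to be checked on `v` and `w`. The action on `Q` is
transitive, and the homomorphism from `Q` to the vertices that sends `v` and `w` to the ends of the
edge is equivariant. Hence it is onto, and it is injective as soon as each element of `W` that
fixes the base vertex fixes `v`.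

By a theorem of Tits (`CoxeterSystem.nonneg_of_not_isLeftDescent`), `W` moves the fundamental
chamber to the far side of the walls of exactly those simple reflections that shorten the given
element. So a nontrivial element that fixes the base vertex can be shortened only by a
reflection whose wall contains this vertex, and by induction on the length it is a product of the
two reflections in lines through the vertex (`Schlafli.stabilizer_induction`). Both of these fix `v`.

The two presentations differ only by the use of `(v * w) * v = w` inside the second relation.
-/

noncomputable section

open Quandles

/-! ### The fundamental chamber of a Coxeter group -/

namespace CoxeterSystem

variable {B W : Type*} [Group W] {M : CoxeterMatrix B} (cs : CoxeterSystem M W)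

/-- The product of `k` factors `sᵢ, sⱼ, sᵢ, …`, beginning with `sᵢ` on the left. -/
def alternatingProd (i j : B) (k : ℕ) : W := (cs.wordProd (alternatingWord j i k))⁻¹

theorem alternatingProd_zero (i j : B) : cs.alternatingProd i j 0 = 1 := by
  simp [alternatingProd, alternatingWord]

theorem alternatingProd_succ (i j : B) (k : ℕ) :
    cs.alternatingProd i j (k + 1) = cs.simple i * cs.alternatingProd j i k := by
  simp [alternatingProd, alternatingWord_succ, wordProd_append]

theorem alternatingProd_succ' (i j : B) (k : ℕ) :
    cs.alternatingProd i j (k + 1) =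
      cs.alternatingProd i j k * cs.simple (if Even k then i else j) := by
  simp [alternatingProd, alternatingWord_succ', wordProd_cons]

theorem length_alternatingProd_le (i j : B) (k : ℕ) : cs.length (cs.alternatingProd i j k) ≤ k := by
  rw [alternatingProd, length_inv]
  simpa using cs.length_wordProd_le (alternatingWord j i k)

theorem alternatingProd_comm (i j : B) :
    cs.alternatingProd i j (M i j) = cs.alternatingProd j i (M i j) := by
  have h := cs.wordProd_braidWord_eq i j
  rw [braidWord, braidWord, M.symmetric j i] at h
  rw [alternatingProd, alternatingProd, h]

/-- The simple roots on a coset of the dihedral subgroup of two simple reflections. As functions of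
`k`, both sides satisfy the recurrence `x (k + 2) = 2 cos θ * x (k + 1) - x k` with `θ = π / mᵢⱼ`, in
which the roles of `i` and `j` alternate. -/
theorem sin_mul_alternatingProd {a : B → W → ℝ}
    (ha : ∀ i j w, a j (cs.simple i * w) = a j w + 2 * Real.cos (Real.pi / M i j) * a i w)
    (i j : B) (v : W) (k : ℕ) :
    Real.sin (Real.pi / M i j) * a j (cs.alternatingProd i j k * v) =
      Real.sin ((k + 1) * (Real.pi / M i j)) * (if Even k then a j v else a i v) +
      Real.sin (k * (Real.pi / M i j)) * (if Even k then a i v else a j v) := by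
  have hself : ∀ i w, a i (cs.simple i * w) = - a i w := by
    intro i w
    rw [ha, M.diagonal]
    simp
    ring
  induction k using Nat.strong_induction_on generalizing i j with
  | _ k ih =>
    match k with
    | 0 => simp [alternatingProd_zero]
    | 1 =>
      simp only [alternatingProd_succ, alternatingProd_zero, mul_one, ha]
      have : Real.sin ((((1 : ℕ) : ℝ) + 1) * (Real.pi / M i j)) =
          2 * Real.sin (Real.pi / M i j) * Real.cos (Real.pi / M i j) := by
        rw [← Real.sin_two_mul]; norm_num
      rw [this]
      simp
      ring
    | k + 2 =>
      have h1 := ih (k + 1) (by omega) j i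
      have h2 := ih k (by omega) i j
      rw [M.symmetric j i] at h1
      rw [alternatingProd_succ, mul_assoc, ha]
      nth_rw 1 [alternatingProd_succ]
      rw [mul_assoc, hself]
      set θ := Real.pi / M i j
      have hs : ∀ c : ℝ, Real.sin ((c + 2) * θ) =
          2 * Real.cos θ * Real.sin ((c + 1) * θ) - Real.sin (c * θ) := by
        intro c
        have e1 : (c + 2) * θ = (c + 1) * θ + θ := by ring
        have e2 : c * θ = (c + 1) * θ - θ := by ring
        rw [e1, e2, Real.sin_add, Real.sin_sub]
        ring
      have s1 := hs k
      have s2 := hs (k + 1)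
      push_cast at h1 h2 ⊢
      rw [show (k : ℝ) + 2 + 1 = k + 1 + 2 by ring, s1, s2]
      rcases Nat.even_or_odd k with hk | hk
      · have hk1 : ¬ Even (k + 1) := by simpa [Nat.even_add_one] using hk
        have hk2 : Even (k + 2) := by simpa [Nat.even_add] using hk
        simp only [hk, hk1, hk2, if_true, if_false] at h1 h2 ⊢
        linear_combination 2 * Real.cos θ * h1 - h2
      · have hk0 : ¬ Even k := by simpa using hk
        have hk1 : Even (k + 1) := by simpa [Nat.even_add_one] using hk
        have hk2 : ¬ Even (k + 2) := by simpa [Nat.even_add] using hk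
        simp only [hk0, hk1, hk2, if_true, if_false] at h1 h2 ⊢
        linear_combination 2 * Real.cos θ * h1 - h2

/-- The number `a i w` stands for the value of the simple root `αᵢ` at `w x`, where `x` is a fixed
point of the closed fundamental chamber of the geometric representation. If `sᵢ w` is longer than
`w`, then the chamber of `w` lies on the positive side of the wall of `sᵢ`. -/
theorem nonneg_of_not_isLeftDescent (hM : ∀ i j, M i j ≠ 0) {a : B → W → ℝ}
    (ha : ∀ i j w, a j (cs.simple i * w) = a j w + 2 * Real.cos (Real.pi / M i j) * a i w)
    (h1 : ∀ i, 0 ≤ a i 1) (w : W) (i : B) (hw : ¬ cs.IsLeftDescent w i) : 0 ≤ a i w := by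
  induction hn : cs.length w using Nat.strong_induction_on generalizing w i with
  | _ n ih =>
  by_cases hw1 : w = 1
  · rw [hw1]; exact h1 i
  obtain ⟨t, ht⟩ := cs.exists_leftDescent_of_ne_one hw1
  have hti : t ≠ i := by rintro rfl; exact hw ht
  -- `P k`: some reduced word of `w` begins with `k` letters alternating between `t` and `i`.
  let P : ℕ → Prop := fun k => ∃ v, w = cs.alternatingProd t i k * v ∧ cs.length w = k + cs.length v
  have hP1 : P 1 := by
    refine ⟨cs.simple t * w, ?_, ?_⟩
    · simp [alternatingProd_succ, alternatingProd_zero]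
    · rw [cs.isLeftDescent_iff] at ht; omega
  have hback : ∀ k v, w = cs.alternatingProd t i (k + 1) * v →
      cs.length w = k + 1 + cs.length v →
      w = cs.alternatingProd t i k * (cs.simple (if Even k then t else i) * v) ∧
      cs.length (cs.simple (if Even k then t else i) * v) = cs.length v + 1 := by
    intro k v hv hl
    have e : w = cs.alternatingProd t i k * (cs.simple (if Even k then t else i) * v) := by
      rw [hv, alternatingProd_succ', mul_assoc]
    refine ⟨e, ?_⟩
    have l1 := cs.length_mul_le (cs.alternatingProd t i k)
      (cs.simple (if Even k then t else i) * v)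
    rw [← e] at l1
    have l2 := cs.length_alternatingProd_le t i k
    rcases cs.length_simple_mul v (if Even k then t else i) with h | h <;> omega
  have hdown : ∀ k l, P (k + l) → P k := by
    intro k l
    induction l with
    | zero => exact id
    | succ l ihl =>
      rintro ⟨v, hv, hl⟩
      obtain ⟨h, h'⟩ := hback (k + l) v hv hl
      exact ihl ⟨_, h, by omega⟩
  -- By the braid relation, `w` would also begin with `i`, which is not a descent.
  have hPM : ¬ P (M t i) := by
    rintro ⟨v, hv, hl⟩
    apply hw
    obtain ⟨k, hk⟩ := Nat.exists_eq_succ_of_ne_zero (hM t i)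
    have e : cs.simple i * w = cs.alternatingProd t i k * v := by
      rw [hv, alternatingProd_comm, hk, alternatingProd_succ, mul_assoc,
        simple_mul_simple_cancel_left]
    have l1 := cs.length_mul_le (cs.alternatingProd t i k) v
    have l2 := cs.length_alternatingProd_le t i k
    rw [IsLeftDescent, e]
    omega
  classical
  obtain ⟨k, hk0, ⟨v, hv, hl⟩, hmax⟩ : ∃ k, 1 ≤ k ∧ P k ∧ ¬ P (k + 1) := by
    by_contra! hcon
    have : ∀ k, P (k + 1) := by
      intro k
      induction k with
      | zero => exact hP1
      | succ k ihk => exact hcon _ (by omega) ihk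
    obtain ⟨v, -, hl⟩ := this (cs.length w)
    omega
  have hkM : k < M t i := by
    by_contra! hle
    obtain ⟨l, rfl⟩ := Nat.exists_eq_add_of_le hle
    exact hPM (hdown _ _ ⟨v, hv, hl⟩)
  obtain ⟨k, rfl⟩ := Nat.exists_eq_add_of_le' hk0
  -- The maximality of the alternating beginning makes both letters ascents of the rest `v`.
  have hnext : 0 ≤ a (if Even (k + 1) then t else i) v := by
    refine ih (cs.length v) (by omega) v _ (fun hd => hmax ?_) rfl
    rw [cs.isLeftDescent_iff] at hd
    refine ⟨cs.simple (if Even (k + 1) then t else i) * v, ?_, by omega⟩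
    rw [alternatingProd_succ', mul_assoc, simple_mul_simple_cancel_left]
    exact hv
  have hlast : 0 ≤ a (if Even k then t else i) v := by
    refine ih (cs.length v) (by omega) v _ (fun hd => ?_) rfl
    have := (hback k v hv hl).2
    rw [cs.isLeftDescent_iff] at hd
    omega
  have hnn : 0 ≤ a t v ∧ 0 ≤ a i v := by
    rcases Nat.even_or_odd k with h | h
    · have h' : ¬ Even (k + 1) := by simpa [Nat.even_add_one] using h
      simp only [h, h', if_true, if_false] at hnext hlast
      exact ⟨hlast, hnext⟩
    · have h0 : ¬ Even k := by simpa using h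
      have h' : Even (k + 1) := by simpa [Nat.even_add_one] using h
      simp only [h0, h', if_true, if_false] at hnext hlast
      exact ⟨hnext, hlast⟩
  have hM2 : 2 ≤ M t i := by
    have := hM t i
    have := M.off_diagonal t i hti
    omega
  have hMpos : (0 : ℝ) < M t i := by positivity
  have hsin : ∀ l : ℕ, l ≤ M t i → 0 ≤ Real.sin (l * (Real.pi / M t i)) := by
    intro l hl
    apply Real.sin_nonneg_of_nonneg_of_le_pi
    · have := Real.pi_pos; positivity
    · rw [← mul_div_assoc, div_le_iff₀ hMpos, mul_comm]
      exact mul_le_mul_of_nonneg_left (by exact_mod_cast hl) Real.pi_pos.le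
  have hpos : 0 < Real.sin (Real.pi / M t i) := by
    apply Real.sin_pos_of_pos_of_lt_pi
    · have := Real.pi_pos; positivity
    · rw [div_lt_iff₀ hMpos]
      have : (2 : ℝ) ≤ M t i := by exact_mod_cast hM2
      nlinarith [Real.pi_pos]
  have key := cs.sin_mul_alternatingProd ha t i v (k + 1)
  rw [← hv] at key
  -- As `k + 1 < m`, both sine coefficients belong to angles in `[0, π]`.
  refine nonneg_of_mul_nonneg_right (a := Real.sin (Real.pi / M t i)) ?_ hpos
  rw [key]
  have s1 := hsin (k + 1) (by omega)
  have s2 := hsin (k + 1 + 1) (by omega)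
  push_cast at s1 s2 ⊢
  refine add_nonneg (mul_nonneg s2 ?_) (mul_nonneg s1 ?_) <;> split_ifs <;> simp [hnn]

end CoxeterSystem

/-! ### The triangle group `(2, 3, m)` and its action on the model surface -/

theorem Module.reflection_mul_reflection_pow_two {R N : Type*} [CommRing R] [AddCommGroup N]
    [Module R N] {x y : N} {f g : Module.Dual R N} (hf : f x = 2) (hg : g y = 2)
    (hfy : f y = 0) (hgx : g x = 0) :
    (Module.reflection hf * Module.reflection hg) ^ 2 = 1 := by
  ext z
  simp only [pow_succ, pow_zero, one_mul, LinearEquiv.mul_apply, Module.reflection_apply, map_sub,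
    map_smul, hf, hg, hfy, hgx, LinearEquiv.coe_one, id]
  module

theorem Module.reflection_mul_reflection_pow_three {R N : Type*} [CommRing R] [AddCommGroup N]
    [Module R N] {x y : N} {f g : Module.Dual R N} (hf : f x = 2) (hg : g y = 2)
    (hfy : f y = 1) (hgx : g x = 1) :
    (Module.reflection hf * Module.reflection hg) ^ 3 = 1 := by
  ext z
  simp only [pow_succ, pow_zero, one_mul, LinearEquiv.mul_apply, Module.reflection_apply, map_sub,
    map_smul, hf, hg, hfy, hgx, LinearEquiv.coe_one, id]
  module

/-- The Coxeter matrix of the symmetry group of `{3, m}`; the indices `0`, `1`, `2` stand for the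
reflection in the edge, in the line to the centre of a face, and in the bisector of the edge. -/
def triangleMatrix (m : ℕ) (hm : 2 ≤ m) : CoxeterMatrix (Fin 3) where
  M := !![1, m, 2; m, 1, 3; 2, 3, 1]
  isSymm := by ext i j; fin_cases i <;> fin_cases j <;> rfl
  diagonal i := by fin_cases i <;> rfl
  off_diagonal i j h := by fin_cases i <;> fin_cases j <;> simp at h ⊢ <;> omega

theorem triangleMatrix_isLiftable {G : Type*} [Group G] {m : ℕ} {hm : 2 ≤ m} {f : Fin 3 → G}
    (h : ∀ i, f i * f i = 1) (h01 : (f 1 * f 0) ^ m = 1) (h02 : (f 0 * f 2) ^ 2 = 1)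
    (h12 : (f 1 * f 2) ^ 3 = 1) : (triangleMatrix m hm).IsLiftable f := by
  have hswap : ∀ i j k, (f i * f j) ^ k = 1 → (f j * f i) ^ k = 1 := by
    intro i j k hk
    have hi : ∀ i, (f i)⁻¹ = f i := fun i => inv_eq_of_mul_eq_one_left (h i)
    rw [← inv_inj, ← inv_pow, mul_inv_rev, hi, hi, hk, inv_one]
  intro i j
  fin_cases i <;> fin_cases j <;>
    simp only [triangleMatrix, Matrix.of_apply, Matrix.cons_val, Fin.zero_eta, Fin.mk_one,
      Fin.reduceFinMk, Fin.isValue, h, pow_one]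
  exacts [hswap _ _ _ h01, h02, h01, h12, hswap _ _ _ h02, hswap _ _ _ h12]

namespace Schlafli

variable {m : ℕ}

theorem sin_pi_div_pos (hm : 2 ≤ m) : 0 < Real.sin (Real.pi / m) := by
  have hm' : (2 : ℝ) ≤ m := by exact_mod_cast hm
  apply Real.sin_pos_of_pos_of_lt_pi
  · have := Real.pi_pos; positivity
  · rw [div_lt_iff₀ (by linarith)]
    nlinarith [Real.pi_pos]

theorem sin_mul_cosHalfEdge (hm : 2 ≤ m) :
    Real.sin (Real.pi / m) * cosHalfEdge 3 m = 1 / 2 := by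
  rw [cosHalfEdge, mul_div_cancel₀ _ (sin_pi_div_pos hm).ne']
  simp

theorem sinHalfEdge_pos (p q : ℕ) : 0 < sinHalfEdge p q := by
  unfold sinHalfEdge
  split_ifs with h
  · exact one_pos
  · exact Real.sqrt_pos.2 (abs_pos.2 (sub_ne_zero.2 (Ne.symm h)))

/-- The three generating reflections of the symmetry group of `{3, m}`. -/
def generator (m : ℕ) : Fin 3 → ((Fin 3 → ℝ) ≃ₗ[ℝ] (Fin 3 → ℝ)) :=
  ![edgeReflection 3 m, faceReflection 3 m, bisectorReflection 3 m]

theorem generator_mem (i : Fin 3) : generator m i ∈ symmetryGroup 3 m := by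
  apply Subgroup.subset_closure
  fin_cases i <;> simp [generator]

theorem generator_mul_self (i : Fin 3) : generator m i * generator m i = 1 := by
  have h (κ : ℝ) (n : Fin 3 → ℝ) (hn : n 0 ^ 2 + n 1 ^ 2 + κ * n 2 ^ 2 = 1) :
      reflection hn * reflection hn = 1 :=
    LinearEquiv.ext (Module.involutive_reflection (functional_normal hn))
  fin_cases i
  exacts [h (curvature 3 m) ![0, 1, 0] (by simp),
    h (curvature 3 m) ![Real.sin (Real.pi / m), -Real.cos (Real.pi / m), 0] (by simp),
    h (curvature 3 m) ![cosHalfEdge 3 m, 0, -sinHalfEdge 3 m]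
      (by simpa using cosHalfEdge_sq_add 3 m)]

theorem rotation_base_apply (κ θ : ℝ) (x : Fin 3 → ℝ) :
    rotation κ θ baseVertex x =
      ![Real.cos θ * x 0 - Real.sin θ * x 1, Real.sin θ * x 0 + Real.cos θ * x 1, x 2] := by
  ext i
  rw [rotation_apply]
  fin_cases i <;> simp [baseVertex, cross, form] <;> ring

theorem rotation_base_pow (k : ℕ) (x : Fin 3 → ℝ) :
    ((generator m 1 * generator m 0) ^ k) x =
      rotation (curvature 3 m) (k * (2 * Real.pi / m)) baseVertex x := by
  induction k with
  | zero =>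
    rw [rotation_base_apply]
    ext i
    fin_cases i <;> simp
  | succ k ih =>
    have h := rotation_base 3 m (((generator m 1 * generator m 0) ^ k) x)
    rw [pow_succ', LinearEquiv.mul_apply]
    refine h.symm.trans ?_
    rw [ih]
    simp only [rotation_base_apply]
    push_cast
    rw [add_mul, one_mul, Real.cos_add, Real.sin_add]
    ext i
    fin_cases i <;> simp <;> ring

theorem generator_isLiftable (hm : 2 ≤ m) :
    (triangleMatrix m hm).IsLiftable (generator m) := by
  refine triangleMatrix_isLiftable generator_mul_self ?_ ?_ ?_
  · ext1 x
    have hm0 : (m : ℝ) ≠ 0 := by positivity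
    rw [rotation_base_pow, mul_div_cancel₀ _ hm0, rotation_base_apply]
    ext i
    fin_cases i <;> simp
  · exact Module.reflection_mul_reflection_pow_two (functional_normal (by simp))
      (functional_normal (by simpa using cosHalfEdge_sq_add 3 m)) (by simp [functional])
      (by simp [functional])
  · have h := sin_mul_cosHalfEdge hm
    refine Module.reflection_mul_reflection_pow_three (functional_normal (by simp))
      (functional_normal (by simpa using cosHalfEdge_sq_add 3 m)) ?_ ?_
    · simp [functional]
      linear_combination 2 * h
    · simp [functional]
      linear_combination 2 * h

/-- The action of the triangle group on the linear model of the surface. -/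
def linearRep (m : ℕ) (hm : 2 ≤ m) :
    (triangleMatrix m hm).Group →* ((Fin 3 → ℝ) ≃ₗ[ℝ] (Fin 3 → ℝ)) :=
  (triangleMatrix m hm).toCoxeterSystem.lift ⟨generator m, generator_isLiftable hm⟩

theorem linearRep_simple (hm : 2 ≤ m) (i : Fin 3) :
    linearRep m hm ((triangleMatrix m hm).toCoxeterSystem.simple i) = generator m i :=
  CoxeterSystem.lift_apply_simple _ _ _

theorem exists_linearRep_eq (hm : 2 ≤ m) {g : (Fin 3 → ℝ) ≃ₗ[ℝ] (Fin 3 → ℝ)}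
    (hg : g ∈ symmetryGroup 3 m) : ∃ ω, linearRep m hm ω = g := by
  have : symmetryGroup 3 m ≤ (linearRep m hm).range := by
    rw [symmetryGroup, Subgroup.closure_le]
    rintro g (rfl | rfl | rfl)
    exacts [⟨_, linearRep_simple hm 0⟩, ⟨_, linearRep_simple hm 1⟩, ⟨_, linearRep_simple hm 2⟩]
  exact this hg

/-- The equations of the sides of the fundamental triangle, positive on its interior. -/
def wall (m : ℕ) : Fin 3 → (Fin 3 → ℝ) → ℝ :=
  ![fun x => x 1,
    fun x => Real.sin (Real.pi / m) * x 0 - Real.cos (Real.pi / m) * x 1,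
    fun x => sinHalfEdge 3 m * x 2 - cosHalfEdge 3 m * x 0]

theorem wall_generator (hm : 2 ≤ m) (i j : Fin 3) (x : Fin 3 → ℝ) :
    wall m j (generator m i x) =
      wall m j x + 2 * Real.cos (Real.pi / triangleMatrix m hm i j) * wall m i x := by
  have h1 := Real.sin_sq_add_cos_sq (Real.pi / m)
  have h2 := cosHalfEdge_sq_add 3 m
  have h3 := sin_mul_cosHalfEdge hm
  fin_cases i <;> fin_cases j <;>
    simp [wall, generator, edgeReflection, faceReflection, bisectorReflection, reflection_apply,
      triangleMatrix]
  · ring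
  · ring
  · ring
  · linear_combination
      -2 * (Real.sin (Real.pi / m) * x 0 - Real.cos (Real.pi / m) * x 1) * h1
  · linear_combination
      2 * (Real.sin (Real.pi / m) * x 0 - Real.cos (Real.pi / m) * x 1) * h3
  · linear_combination 2 * (sinHalfEdge 3 m * x 2 - cosHalfEdge 3 m * x 0) * h3
  · linear_combination -2 * (sinHalfEdge 3 m * x 2 - cosHalfEdge 3 m * x 0) * h2

theorem wall_base_nonneg (i : Fin 3) : 0 ≤ wall m i baseVertex := by
  fin_cases i <;> simp [wall, baseVertex, (sinHalfEdge_pos 3 m).le]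

theorem generator_base {i : Fin 3} (hi : i ≠ 2) : generator m i baseVertex = baseVertex := by
  ext j
  fin_cases i
  · fin_cases j <;> simp [generator, edgeReflection, reflection_apply, baseVertex]
  · fin_cases j <;> simp [generator, faceReflection, reflection_apply, baseVertex]
  · exact absurd rfl hi

/-- The stabilizer of the base vertex in the triangle group is generated by the two reflections
in the lines through it: if `w ≠ 1` fixes the base vertex, then the wall of a left descent of `w`
passes through it. -/
theorem stabilizer_induction (hm : 2 ≤ m) {P : (triangleMatrix m hm).Group → Prop} (one : P 1)
    (edge : ∀ ω, P ω → P ((triangleMatrix m hm).toCoxeterSystem.simple 0 * ω))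
    (face : ∀ ω, P ω → P ((triangleMatrix m hm).toCoxeterSystem.simple 1 * ω))
    (ω : (triangleMatrix m hm).Group) (hω : linearRep m hm ω baseVertex = baseVertex) : P ω := by
  set cs := (triangleMatrix m hm).toCoxeterSystem
  induction hn : cs.length ω using Nat.strong_induction_on generalizing ω with
  | _ n ih =>
  by_cases h1 : ω = 1
  · rwa [h1]
  obtain ⟨i, hi⟩ := cs.exists_leftDescent_of_ne_one h1
  have hM : ∀ i j, triangleMatrix m hm i j ≠ 0 := by
    intro i j
    fin_cases i <;> fin_cases j <;> simp [triangleMatrix] <;> omega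
  have hle : wall m i baseVertex ≤ 0 := by
    have h := cs.nonneg_of_not_isLeftDescent hM
      (a := fun i w => wall m i (linearRep m hm w baseVertex))
      (fun i j w => by
        rw [map_mul, LinearEquiv.mul_apply, linearRep_simple, wall_generator hm])
      (fun i => by simpa using wall_base_nonneg i) (cs.simple i * ω) i
      (cs.isLeftDescent_iff_not_isLeftDescent_mul.1 hi)
    rw [map_mul, LinearEquiv.mul_apply, hω, linearRep_simple, wall_generator hm,
      (triangleMatrix m hm).diagonal] at h
    simp at h
    linarith
  have hstep : generator m i baseVertex = baseVertex →
      P (cs.simple i * ω) := by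
    intro hfix
    refine ih _ ?_ _ ?_ rfl
    · rw [← hn]; exact hi
    · rw [map_mul, LinearEquiv.mul_apply, hω, linearRep_simple, hfix]
  have hcancel : cs.simple i * (cs.simple i * ω) = ω := cs.simple_mul_simple_cancel_left i
  rw [← hcancel]
  fin_cases i
  · exact edge _ (hstep (generator_base (by decide)))
  · exact face _ (hstep (generator_base (by decide)))
  · simp [wall, baseVertex] at hle
    exact absurd hle (not_le.2 (sinHalfEdge_pos 3 m))

end Schlafli

/-! ### Homomorphisms and antihomomorphisms from presented quandles -/

namespace QuandleWord

/-- The value of a word in a quandle whose elements `f s` are substituted for the generators. -/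
def eval {S X : Type*} [Quandle X] (f : S → X) : QuandleWord S → X
  | gen s => f s
  | star a b => b.eval f ◃ a.eval f
  | starInv a b => b.eval f ◃⁻¹ a.eval f

theorem eval_eq {S X : Type*} [Quandle X] (f : S → X) {R : Set (QuandleWord S × QuandleWord S)}
    (hf : ∀ r ∈ R, r.1.eval f = r.2.eval f) {a b : QuandleWord S} (h : Equal R a b) :
    a.eval f = b.eval f := by
  induction h with
  | rel h => exact hf _ h
  | refl => rfl
  | symm _ ih => exact ih.symm
  | trans _ _ ih ih' => exact ih.trans ih'
  | congr_star _ _ ih ih' => simp only [eval, ih, ih']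
  | congr_starInv _ _ ih ih' => simp only [eval, ih, ih']
  | idem a => exact Quandle.fix
  | star_starInv a b => exact Rack.invAct_act_eq _ _
  | starInv_star a b => exact Rack.act_invAct_eq _ _
  | distrib a b c => exact Shelf.self_distrib

theorem eval_starPow {S X : Type*} [Quandle X] (f : S → X) (a b : QuandleWord S) (k : ℕ) :
    (a.starPow b k).eval f = (Shelf.act (b.eval f))^[k] (a.eval f) := by
  induction k with
  | zero => rfl
  | succ k ih =>
    rw [starPow, Function.iterate_succ_apply', Function.iterate_succ_apply', ← ih]
    rfl

end QuandleWord

namespace PresentedQuandle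

/-- The homomorphism given by a choice of images of the generators that satisfies the relations. -/
def lift {S X : Type*} [Quandle X] {R : Set (QuandleWord S × QuandleWord S)} (f : S → X)
    (hf : ∀ r ∈ R, r.1.eval f = r.2.eval f) : PresentedQuandle R →◃ X where
  toFun := Quotient.lift (QuandleWord.eval f) fun _ _ h => QuandleWord.eval_eq f hf h
  map_act' := by rintro ⟨a⟩ ⟨b⟩; rfl

theorem mk_eq_eval {S : Type*} (R : Set (QuandleWord S × QuandleWord S)) (a : QuandleWord S) :
    mk R a = a.eval (of R) := by
  induction a with
  | gen s => rfl
  | star a b iha ihb => rw [QuandleWord.eval, ← iha, ← ihb]; rfl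
  | starInv a b iha ihb => rw [QuandleWord.eval, ← iha, ← ihb]; rfl

theorem eval_of_eq {S : Type*} {R : Set (QuandleWord S × QuandleWord S)}
    {r : QuandleWord S × QuandleWord S} (h : r ∈ R) : r.1.eval (of R) = r.2.eval (of R) := by
  rw [← mk_eq_eval, ← mk_eq_eval]
  exact Quotient.sound (.rel h)

theorem induction {S : Type*} {R : Set (QuandleWord S × QuandleWord S)}
    {P : PresentedQuandle R → Prop} (gen : ∀ s, P (of R s)) (act : ∀ x y, P x → P y → P (y ◃ x))
    (invAct : ∀ x y, P x → P y → P (y ◃⁻¹ x)) (x : PresentedQuandle R) : P x := by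
  obtain ⟨a⟩ := x
  induction a with
  | gen s => exact gen s
  | star a b iha ihb => exact act _ _ iha ihb
  | starInv a b iha ihb => exact invAct _ _ iha ihb

end PresentedQuandle

theorem ShelfHom.map_invAct {X Y : Type*} [Rack X] [Rack Y] (f : X →◃ Y) (x y : X) :
    f (y ◃⁻¹ x) = f y ◃⁻¹ f x := by
  rw [← Rack.left_cancel (f y), ← f.map_act, Rack.act_invAct_eq, Rack.act_invAct_eq]

/-- The action of an element of a rack is an endomorphism. -/
def ShelfHom.actHom {X : Type*} [Shelf X] (x : X) : X →◃ X where
  toFun := Shelf.act x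
  map_act' := Shelf.self_distrib

theorem PresentedQuandle.hom_ext {S X : Type*} [Rack X] {R : Set (QuandleWord S × QuandleWord S)}
    {f g : PresentedQuandle R →◃ X} (h : ∀ s, f (of R s) = g (of R s)) (x : PresentedQuandle R) :
    f x = g x := by
  induction x using PresentedQuandle.induction with
  | gen s => exact h s
  | act x y hx hy => rw [f.map_act, g.map_act, hx, hy]
  | invAct x y hx hy => rw [f.map_invAct, g.map_invAct, hx, hy]

/-- An antihomomorphism of racks carries the action to the inverse action. An
orientation-reversing isometry has this effect on rotations. -/
def IsAntihom {X Y : Type*} [Rack X] [Rack Y] (F : X → Y) : Prop :=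
  ∀ x y, F (y ◃ x) = F y ◃⁻¹ F x

namespace IsAntihom

variable {X Y Z : Type*} [Rack X] [Rack Y] [Rack Z] {F : X → Y} {G : Y → Z}

theorem map_invAct (hF : IsAntihom F) (x y : X) : F (y ◃⁻¹ x) = F y ◃ F x := by
  rw [← Rack.left_cancel_inv (F y), ← hF, Rack.act_invAct_eq, Rack.invAct_act_eq]

/-- The composition of two antihomomorphisms, as a homomorphism. -/
def comp (hG : IsAntihom G) (hF : IsAntihom F) : X →◃ Z where
  toFun := G ∘ F
  map_act' := by intro x y; simp only [Function.comp, hF y x, hG.map_invAct]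

theorem hom_comp (f : Y →◃ Z) (hF : IsAntihom F) : IsAntihom (f ∘ F) := by
  intro x y
  simp only [Function.comp, hF x y, f.map_invAct]

end IsAntihom

/-! ### The presented quandle and its symmetries -/

namespace SchlafliPresentation

/-- The quandle with the first presentation. -/
abbrev Q (m : ℕ) : Type := PresentedQuandle (schlafliRelations m)

/-- The generator `v`. -/
abbrev v (m : ℕ) : Q m := PresentedQuandle.of _ 0

/-- The generator `w`. -/
abbrev w (m : ℕ) : Q m := PresentedQuandle.of _ 1

variable {m : ℕ}

theorem v_w_v : v m ◃ (w m ◃ v m) = w m :=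
  PresentedQuandle.eval_of_eq (R := schlafliRelations m) (Or.inl rfl)

theorem w_v_w : w m ◃ (v m ◃ w m) = v m :=
  PresentedQuandle.eval_of_eq (R := schlafliRelations m) (Or.inr (Or.inl rfl))

theorem v_pow_w : (Rack.act' (v m) ^ m) (w m) = w m := by
  have h := PresentedQuandle.eval_of_eq (R := schlafliRelations m) (Or.inr (Or.inr rfl))
  rw [QuandleWord.eval_starPow] at h
  rw [Equiv.Perm.coe_pow]
  exact h

theorem exists_hom {X : Type*} [Quandle X] (a b : X) (h1 : a ◃ b ◃ a = b) (h2 : b ◃ a ◃ b = a)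
    (h3 : (Shelf.act a)^[m] b = b) : ∃ e : Q m →◃ X, e (v m) = a ∧ e (w m) = b := by
  refine ⟨PresentedQuandle.lift ![a, b] ?_, rfl, rfl⟩
  rintro r (rfl | rfl | rfl)
  · exact h1
  · exact h2
  · rw [QuandleWord.eval_starPow]
    exact h3

/-- The action of `v` is an automorphism which fixes `v`, and its `m`-th power fixes `w` too. -/
theorem act_v_pow : Rack.act' (v m) ^ m = 1 := by
  have hmap : ∀ (k : ℕ) (x y : Q m), (Rack.act' (v m) ^ k) (x ◃ y) =
      (Rack.act' (v m) ^ k) x ◃ (Rack.act' (v m) ^ k) y := by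
    intro k x y
    induction k with
    | zero => rfl
    | succ k ih =>
      rw [pow_succ', Equiv.Perm.mul_apply, ih]
      exact (ShelfHom.actHom (v m)).map_act
  have hv : ∀ k : ℕ, (Rack.act' (v m) ^ k) (v m) = v m := by
    intro k
    induction k with
    | zero => rfl
    | succ k ih =>
      rw [pow_succ', Equiv.Perm.mul_apply, ih, Rack.act'_apply, Quandle.fix]
  ext x
  refine PresentedQuandle.hom_ext (f := ⟨_, hmap m _ _⟩) (g := ShelfHom.id _) (fun s => ?_) x
  fin_cases s
  · exact hv m
  · exact v_pow_w

theorem act_w_eq :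
    Rack.act' (w m) = (Rack.act' (v m) * Rack.act' (w m)) * Rack.act' (v m) *
      (Rack.act' (v m) * Rack.act' (w m))⁻¹ := by
  conv_lhs => rw [← v_w_v]
  rw [Rack.ad_conj, Rack.ad_conj]
  group

theorem act_w_pow : Rack.act' (w m) ^ m = 1 := by
  rw [act_w_eq, conj_pow, act_v_pow]
  group

/-- The defining relations for the inverse operation give an antihomomorphism. -/
theorem exists_antihom (a b : Q m) (h1 : a ◃⁻¹ b ◃⁻¹ a = b) (h2 : b ◃⁻¹ a ◃⁻¹ b = a)
    (h3 : (Rack.act' a ^ m) b = b) : ∃ F : Q m → Q m, IsAntihom F ∧ F (v m) = a ∧ F (w m) = b := by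
  have hpow : ∀ (k : ℕ) (x : Q m), (Shelf.act (MulOpposite.op a))^[k] (MulOpposite.op x) =
      MulOpposite.op (((Rack.act' a)⁻¹ ^ k) x) := by
    intro k x
    induction k with
    | zero => rfl
    | succ k ih => rw [Function.iterate_succ_apply', ih, pow_succ']; rfl
  obtain ⟨e, hv, hw⟩ := exists_hom (m := m) (MulOpposite.op a) (MulOpposite.op b)
    (congrArg MulOpposite.op h1) (congrArg MulOpposite.op h2) (by
      rw [hpow, inv_pow]
      exact congrArg MulOpposite.op (Equiv.Perm.inv_eq_iff_eq.2 h3.symm))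
  refine ⟨fun x => (e x).unop, fun x y => ?_, congrArg MulOpposite.unop hv,
    congrArg MulOpposite.unop hw⟩
  change (e (y ◃ x)).unop = _
  rw [e.map_act]
  rfl

theorem inv_v_w_v : v m ◃⁻¹ w m ◃⁻¹ v m = w m := by
  rw [← Rack.left_cancel (v m), ← Rack.left_cancel (w m), Rack.act_invAct_eq, Rack.act_invAct_eq,
    w_v_w]

theorem inv_w_v_w : w m ◃⁻¹ v m ◃⁻¹ w m = v m := by
  rw [← Rack.left_cancel (w m), ← Rack.left_cancel (v m), Rack.act_invAct_eq, Rack.act_invAct_eq,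
    v_w_v]

/-- The triangle group acts on the presented quandle as on the tessellation: reflections reverse
the quandle operation, the reflection in the edge `vw` fixes its ends, the bisector reflection
exchanges them, and the product of the two reflections in lines through `v` is the rotation
about `v`. -/
theorem exists_rep (hm : 2 ≤ m) : ∃ ρ : (triangleMatrix m hm).Group →* Equiv.Perm (Q m),
    (∀ i, IsAntihom (ρ ((triangleMatrix m hm).toCoxeterSystem.simple i))) ∧
    ρ ((triangleMatrix m hm).toCoxeterSystem.simple 0) (v m) = v m ∧
    ρ ((triangleMatrix m hm).toCoxeterSystem.simple 0) (w m) = w m ∧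
    ρ ((triangleMatrix m hm).toCoxeterSystem.simple 2) (v m) = w m ∧
    ρ ((triangleMatrix m hm).toCoxeterSystem.simple 2) (w m) = v m ∧
    ∀ x, ρ ((triangleMatrix m hm).toCoxeterSystem.simple 1) x =
      v m ◃ ρ ((triangleMatrix m hm).toCoxeterSystem.simple 0) x := by
  obtain ⟨S, hS, hSv, hSw⟩ := exists_antihom (v m) (w m) inv_v_w_v inv_w_v_w v_pow_w
  obtain ⟨U, hU, hUv, hUw⟩ := exists_antihom (w m) (v m) inv_w_v_w inv_v_w_v
    (by rw [act_w_pow]; rfl)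
  have ext_id : ∀ f : Q m →◃ Q m, f (v m) = v m → f (w m) = w m → ∀ x, f x = x := by
    intro f h0 h1 x
    refine PresentedQuandle.hom_ext (f := f) (g := ShelfHom.id _) (fun s => ?_) x
    fin_cases s
    exacts [h0, h1]
  have hSS : Function.Involutive S := ext_id (hS.comp hS)
    (show S (S _) = _ by rw [hSv, hSv]) (show S (S _) = _ by rw [hSw, hSw])
  have hUU : Function.Involutive U := ext_id (hU.comp hU)
    (show U (U _) = _ by rw [hUv, hUw]) (show U (U _) = _ by rw [hUw, hUv])
  let T : Equiv.Perm (Q m) := Rack.act' (v m) * hSS.toPerm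
  have hT : IsAntihom T := hS.hom_comp (ShelfHom.actHom (v m))
  let f : Fin 3 → Equiv.Perm (Q m) := ![hSS.toPerm, T, hUU.toPerm]
  have hf : (triangleMatrix m hm).IsLiftable f := by
    refine triangleMatrix_isLiftable ?_ ?_ ?_ ?_
    · intro i
      fin_cases i
      · exact Equiv.ext hSS
      · ext x
        change v m ◃ S (v m ◃ S x) = x
        rw [hS, hSv, Rack.act_invAct_eq, hSS]
      · exact Equiv.ext hUU
    · have h : f 1 * f 0 = Rack.act' (v m) := by
        ext x
        change v m ◃ S (S x) = v m ◃ x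
        rw [hSS]
      rw [h, act_v_pow]
    · ext x
      refine ext_id ((hS.comp hU).comp (hS.comp hU)) ?_ ?_ x
      · change S (U (S (U _))) = _
        rw [hUv, hSw, hUw, hSv]
      · change S (U (S (U _))) = _
        rw [hUw, hSv, hUv, hSw]
    · -- The product of the face and bisector reflections permutes `v`, `v ◃ w`, `w` cyclically.
      have hD : ∀ x, hT.comp hU x = v m ◃ S (U x) := fun _ => rfl
      have h1 : hT.comp hU (v m) = v m ◃ w m := by rw [hD, hUv, hSw]
      have h2 : hT.comp hU (w m) = v m := by rw [hD, hUw, hSv, Quandle.fix]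
      have h3 : hT.comp hU (v m ◃ w m) = w m := by
        rw [ShelfHom.map_act, h1, h2]
        have h := DFunLike.congr_fun (Rack.ad_conj (v m) (w m)) (v m)
        simp only [Rack.act'_apply, Equiv.Perm.mul_apply, Rack.invAct_apply, Quandle.fix_inv] at h
        rw [h, v_w_v]
      ext x
      refine ext_id ((hT.comp hU).comp ((hT.comp hU).comp (hT.comp hU))) ?_ ?_ x
      · rw [ShelfHom.comp_apply, ShelfHom.comp_apply, h1, h3, h2]
      · rw [ShelfHom.comp_apply, ShelfHom.comp_apply, h2, h1, h3]
  refine ⟨(triangleMatrix m hm).toCoxeterSystem.lift ⟨f, hf⟩, ?_⟩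
  simp only [CoxeterSystem.lift_apply_simple]
  refine ⟨fun i => ?_, hSv, hSw, hUv, hUw, fun _ => rfl⟩
  fin_cases i
  exacts [hS, hT, hU]

end SchlafliPresentation

/-! ### The comparison of the presented quandle with the tessellation -/

namespace SchlafliPresentation

open Schlafli

variable {m : ℕ}

theorem rotation_generator (i : Fin 3) (θ : ℝ) (y x : Fin 3 → ℝ) :
    rotation (curvature 3 m) θ (generator m i y) (generator m i x) =
      generator m i (rotation (curvature 3 m) (-θ) y x) := by
  have h (n : Fin 3 → ℝ) (hn : n 0 ^ 2 + n 1 ^ 2 + curvature 3 m * n 2 ^ 2 = 1) :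
      rotation (curvature 3 m) θ (reflection hn y) (reflection hn x) =
        reflection hn (rotation (curvature 3 m) (-θ) y x) := by
    rw [rotation_map (Or.inr rfl) (reflection_form hn) (reflection_cross hn), neg_one_mul]
  fin_cases i
  exacts [h ![0, 1, 0] (by simp),
    h ![Real.sin (Real.pi / m), -Real.cos (Real.pi / m), 0] (by simp),
    h ![cosHalfEdge 3 m, 0, -sinHalfEdge 3 m] (by simpa using cosHalfEdge_sq_add 3 m)]

/-- The base vertex as an element of the Schläfli quandle. -/
def vertexV (m : ℕ) : SchlafliQuandle 3 m := ⟨baseVertex, 1, one_mem _, rfl⟩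

/-- The vertex at the other end of the edge. -/
def vertexW (m : ℕ) : SchlafliQuandle 3 m :=
  ⟨generator m 2 baseVertex, generator m 2, generator_mem 2, rfl⟩

theorem vertexV_act (x : SchlafliQuandle 3 m) :
    (vertexV m ◃ x).1 = (generator m 1 * generator m 0) x.1 :=
  rotation_base 3 m x.1

theorem vertexW_act (x : SchlafliQuandle 3 m) :
    (vertexW m ◃ x).1 =
      (generator m 2 * generator m 0 * generator m 1 * generator m 2) x.1 := by
  have hinv (i : Fin 3) : (generator m i)⁻¹ = generator m i :=
    inv_eq_of_mul_eq_one_left (generator_mul_self i)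
  have h := rotation_generator (m := m) 2 (2 * Real.pi / m) baseVertex (generator m 2 x.1)
  rw [rotation_neg_base, ← LinearEquiv.mul_apply, ← LinearEquiv.mul_apply, generator_mul_self] at h
  refine h.trans ?_
  change (generator m 2 * (generator m 1 * generator m 0)⁻¹) (generator m 2 x.1) = _
  rw [mul_inv_rev, hinv, hinv, ← mul_assoc]
  rfl

theorem vertexV_act_iterate (k : ℕ) (x : SchlafliQuandle 3 m) :
    ((Shelf.act (vertexV m))^[k] x).1 = ((generator m 1 * generator m 0) ^ k) x.1 := by
  induction k with
  | zero => rfl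
  | succ k ih =>
    rw [Function.iterate_succ_apply', vertexV_act, ih, pow_succ']
    rfl

theorem exists_homToTessellation (hm : 2 ≤ m) :
    ∃ e : Q m →◃ SchlafliQuandle 3 m, e (v m) = vertexV m ∧ e (w m) = vertexW m := by
  have hl := generator_isLiftable hm
  have h0 : generator m 0 baseVertex = baseVertex := generator_base (by decide)
  have h1 : generator m 1 baseVertex = baseVertex := generator_base (by decide)
  have hsq (i : Fin 3) (x : Fin 3 → ℝ) : generator m i (generator m i x) = x :=
    LinearEquiv.congr_fun (generator_mul_self i) x
  have h02 (x : Fin 3 → ℝ) :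
      generator m 0 (generator m 2 x) = generator m 2 (generator m 0 x) := by
    have h : (generator m 0 * generator m 2) ^ 2 = 1 := hl 0 2
    have h' := LinearEquiv.congr_fun h (generator m 2 (generator m 0 x))
    simpa [pow_succ, hsq] using h'
  have h12 (x : Fin 3 → ℝ) : generator m 1 (generator m 2 (generator m 1 x)) =
      generator m 2 (generator m 1 (generator m 2 x)) := by
    have h : (generator m 1 * generator m 2) ^ 3 = 1 := hl 1 2
    have h' := LinearEquiv.congr_fun h (generator m 2 (generator m 1 (generator m 2 x)))
    simpa [pow_succ, hsq] using h'
  refine exists_hom (vertexV m) (vertexW m) ?_ ?_ ?_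
  · apply Subtype.ext
    rw [vertexV_act, vertexW_act]
    simp only [LinearEquiv.mul_apply, vertexV, vertexW]
    rw [h02 (generator m 0 _), hsq, h12, hsq, h1]
  · apply Subtype.ext
    rw [vertexW_act, vertexV_act]
    simp only [LinearEquiv.mul_apply, vertexV, vertexW]
    rw [h02 baseVertex, h0, h12, hsq, h1, h02, hsq, h0]
  · apply Subtype.ext
    have h : (generator m 1 * generator m 0) ^ m = 1 := hl 1 0
    rw [vertexV_act_iterate, h]
    rfl

/-- The quandle with the first presentation is isomorphic to the Schläfli quandle. -/
theorem exists_isoTessellation (hm : 2 ≤ m) :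
    ∃ e : Q m →◃ SchlafliQuandle 3 m, Function.Bijective e := by
  obtain ⟨e, hev, hew⟩ := exists_homToTessellation hm
  obtain ⟨ρ, hanti, h0v, h0w, h2v, h2w, h1⟩ := exists_rep hm
  set cs := (triangleMatrix m hm).toCoxeterSystem
  have hstep : ∀ i, (e (ρ (cs.simple i) (v m))).1 = generator m i (e (v m)).1 →
      (e (ρ (cs.simple i) (w m))).1 = generator m i (e (w m)).1 →
      ∀ x, (e (ρ (cs.simple i) x)).1 = generator m i (e x).1 := by
    intro i hv hw x
    induction x using PresentedQuandle.induction with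
    | gen s =>
      fin_cases s
      exacts [hv, hw]
    | act x y hx hy =>
      rw [hanti i, e.map_invAct, e.map_act]
      change rotation (curvature 3 m) (-(2 * Real.pi / m)) _ _ = _
      rw [hx, hy, rotation_generator, neg_neg]
      rfl
    | invAct x y hx hy =>
      rw [(hanti i).map_invAct, e.map_invAct, e.map_act]
      change rotation (curvature 3 m) (2 * Real.pi / m) _ _ = _
      rw [hx, hy, rotation_generator]
      rfl
  have hb0 : generator m 0 baseVertex = baseVertex := generator_base (by decide)
  have hsq (i : Fin 3) (x : Fin 3 → ℝ) : generator m i (generator m i x) = x :=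
    LinearEquiv.congr_fun (generator_mul_self i) x
  have hequiv0 : ∀ x, (e (ρ (cs.simple 0) x)).1 = generator m 0 (e x).1 := by
    refine hstep 0 ?_ ?_
    · rw [h0v, hev]
      exact hb0.symm
    · have h : (generator m 0 * generator m 2) ^ 2 = 1 := generator_isLiftable hm 0 2
      have h' := LinearEquiv.congr_fun h (generator m 2 (generator m 0 baseVertex))
      rw [h0w, hew]
      simp only [pow_succ, pow_zero, one_mul, LinearEquiv.mul_apply, hsq, LinearEquiv.coe_one, id,
        hb0] at h'
      exact h'.symm
  have hequiv : ∀ ω x, (e (ρ ω x)).1 = linearRep m hm ω (e x).1 := by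
    intro ω
    induction ω using cs.simple_induction_left with
    | one => intro x; simp
    | mul_simple_left ω i ih =>
      intro x
      rw [map_mul, map_mul, Equiv.Perm.mul_apply, LinearEquiv.mul_apply, linearRep_simple, ← ih]
      generalize ρ ω x = y
      fin_cases i
      · exact hequiv0 y
      · change (e (ρ (cs.simple 1) y)).1 = _
        rw [h1, e.map_act, hev, vertexV_act, hequiv0, LinearEquiv.mul_apply, hsq]
        rfl
      · refine hstep 2 ?_ ?_ y
        · rw [h2v, hew, hev]
          rfl
        · rw [h2w, hew, hev]
          exact (hsq 2 _).symm
  -- Every element of the triangle group preserves or reverses the quandle operation.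
  have horient : ∀ ω, (∀ x y, ρ ω (y ◃ x) = ρ ω y ◃ ρ ω x) ∨ IsAntihom (ρ ω) := by
    intro ω
    induction ω using cs.simple_induction_left with
    | one => exact Or.inl fun x y => by simp
    | mul_simple_left ω i ih =>
      rcases ih with ih | ih
      · right
        intro x y
        simp only [map_mul, Equiv.Perm.mul_apply, ih, hanti i _ _]
      · left
        intro x y
        simp only [map_mul, Equiv.Perm.mul_apply, ih x y, (hanti i).map_invAct]
  have hrot : ∀ x, ρ (cs.simple 1 * cs.simple 0) x = v m ◃ x := by
    intro x
    rw [map_mul, Equiv.Perm.mul_apply, h1, ← Equiv.Perm.mul_apply (ρ (cs.simple 0)), ← map_mul,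
      cs.simple_mul_simple_self, map_one, Equiv.Perm.one_apply]
  have hrot' : ∀ x, ρ (cs.simple 1 * cs.simple 0)⁻¹ x = v m ◃⁻¹ x := by
    intro x
    rw [map_inv, Equiv.Perm.inv_eq_iff_eq, hrot, Rack.act_invAct_eq]
  -- The actions of the elements of the orbit of `v` are conjugate to that of `v` or to its inverse.
  have hconj : ∀ ω x, ∃ τ, ρ ω (v m) ◃ x = ρ τ x ∧ ρ ω (v m) ◃⁻¹ x = ρ τ⁻¹ x := by
    intro ω x
    have hx : ∀ x, ρ ω (ρ ω⁻¹ x) = x := fun x => by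
      rw [← Equiv.Perm.mul_apply, ← map_mul, mul_inv_cancel, map_one, Equiv.Perm.one_apply]
    rcases horient ω with h | h
    · refine ⟨ω * (cs.simple 1 * cs.simple 0) * ω⁻¹, ?_, ?_⟩
      · rw [map_mul, map_mul, Equiv.Perm.mul_apply, Equiv.Perm.mul_apply, hrot, h, hx]
      · rw [← Rack.left_cancel (ρ ω (v m)), Rack.act_invAct_eq, conj_inv, map_mul, map_mul,
          Equiv.Perm.mul_apply, Equiv.Perm.mul_apply, hrot', ← h, Rack.act_invAct_eq, hx]
    · refine ⟨ω * (cs.simple 1 * cs.simple 0)⁻¹ * ω⁻¹, ?_, ?_⟩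
      · rw [map_mul, map_mul, Equiv.Perm.mul_apply, Equiv.Perm.mul_apply, hrot', h.map_invAct, hx]
      · rw [conj_inv, inv_inv, map_mul, map_mul, Equiv.Perm.mul_apply, Equiv.Perm.mul_apply, hrot,
          h, hx]
  have htrans : ∀ x, ∃ ω, ρ ω (v m) = x := by
    intro x
    induction x using PresentedQuandle.induction with
    | gen s =>
      fin_cases s
      exacts [⟨1, by simp⟩, ⟨cs.simple 2, h2v⟩]
    | act x y hx hy =>
      obtain ⟨ω, rfl⟩ := hx
      obtain ⟨ω', rfl⟩ := hy
      obtain ⟨τ, hτ, -⟩ := hconj ω' (ρ ω (v m))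
      exact ⟨τ * ω, by rw [hτ, map_mul, Equiv.Perm.mul_apply]⟩
    | invAct x y hx hy =>
      obtain ⟨ω, rfl⟩ := hx
      obtain ⟨ω', rfl⟩ := hy
      obtain ⟨τ, -, hτ⟩ := hconj ω' (ρ ω (v m))
      exact ⟨τ⁻¹ * ω, by rw [hτ, map_mul, Equiv.Perm.mul_apply]⟩
  have hval : ∀ ω, (e (ρ ω (v m))).1 = linearRep m hm ω baseVertex := by
    intro ω
    rw [hequiv, hev]
    rfl
  have hstab : ∀ ω, linearRep m hm ω baseVertex = baseVertex → ρ ω (v m) = v m := by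
    refine stabilizer_induction hm (by simp) (fun ω h => ?_) (fun ω h => ?_)
    · rw [map_mul, Equiv.Perm.mul_apply, h, h0v]
    · rw [map_mul, Equiv.Perm.mul_apply, h, h1, h0v, Quandle.fix]
  refine ⟨e, fun x y hxy => ?_, fun z => ?_⟩
  · obtain ⟨ω, rfl⟩ := htrans x
    obtain ⟨ω', rfl⟩ := htrans y
    have h := congrArg Subtype.val hxy
    rw [hval, hval] at h
    have h' := hstab (ω'⁻¹ * ω) (by
      rw [map_mul, LinearEquiv.mul_apply, h, ← LinearEquiv.mul_apply, ← map_mul, inv_mul_cancel,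
        map_one]
      rfl)
    rwa [map_mul, Equiv.Perm.mul_apply, map_inv, Equiv.Perm.inv_eq_iff_eq] at h'
  · obtain ⟨g, hg, hz⟩ := z.2
    obtain ⟨ω, rfl⟩ := exists_linearRep_eq hm hg
    exact ⟨ρ ω (v m), Subtype.ext ((hval ω).trans hz)⟩

/-- The two presentations have the same consequences: in the presence of `(v * w) * v = w`, the
words `(((v * w) * v) * v) * w` and `(w * v) * w` are equal. -/
theorem exists_isoSecondPresentation (m : ℕ) :
    ∃ c : PresentedQuandle (schlafliRelations' m) →◃ Q m, Function.Bijective c ∧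
      ∀ s, c (PresentedQuandle.of _ s) = PresentedQuandle.of _ s := by
  let R := schlafliRelations m
  let R' := schlafliRelations' m
  let v' : PresentedQuandle R' := PresentedQuandle.of R' 0
  let w' : PresentedQuandle R' := PresentedQuandle.of R' 1
  have r1 : v' ◃ w' ◃ v' = w' := PresentedQuandle.eval_of_eq (R := R') (Or.inl rfl)
  have r2 : w' ◃ v' ◃ v' ◃ w' ◃ v' = v' :=
    PresentedQuandle.eval_of_eq (R := R') (Or.inr (Or.inl rfl))
  have r3 := PresentedQuandle.eval_of_eq (R := R') (Or.inr (Or.inr rfl))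
  let c : PresentedQuandle R' →◃ PresentedQuandle R :=
    PresentedQuandle.lift (PresentedQuandle.of R) (by
      rintro r (rfl | rfl | rfl)
      · exact v_w_v
      · change w m ◃ v m ◃ v m ◃ w m ◃ v m = v m
        rw [v_w_v, w_v_w]
      · exact PresentedQuandle.eval_of_eq (R := R) (Or.inr (Or.inr rfl)))
  let d : PresentedQuandle R →◃ PresentedQuandle R' :=
    PresentedQuandle.lift (PresentedQuandle.of R') (by
      rintro r (rfl | rfl | rfl)
      · exact r1
      · change w' ◃ v' ◃ w' = v'
        rwa [r1] at r2
      · exact r3)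
  refine ⟨c, Function.bijective_iff_has_inverse.2 ⟨d, fun x => ?_, fun x => ?_⟩, fun s => rfl⟩
  · exact PresentedQuandle.hom_ext (f := d.comp c) (g := ShelfHom.id _) (fun s => rfl) x
  · exact PresentedQuandle.hom_ext (f := c.comp d) (g := ShelfHom.id _) (fun s => rfl) x

end SchlafliPresentation

end

open Quandles in
theorem mainTheorem3 (m : ℕ) (hm : 2 ≤ m) :
    ∃ (e : PresentedQuandle (schlafliRelations m) →◃ SchlafliQuandle 3 m)
      (e' : PresentedQuandle (schlafliRelations' m) →◃ SchlafliQuandle 3 m),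
      Function.Bijective e ∧ Function.Bijective e' ∧
      ∀ s : Fin 2, e (PresentedQuandle.of _ s) = e' (PresentedQuandle.of _ s) := by
  obtain ⟨e, he⟩ := SchlafliPresentation.exists_isoTessellation hm
  obtain ⟨c, hc, hgen⟩ := SchlafliPresentation.exists_isoSecondPresentation m
  refine ⟨e, e.comp c, he, he.comp hc, fun s => ?_⟩
  rw [ShelfHom.comp_apply, hgen]
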